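/- \textbf{The model.} Start with the graph consisting of the single vertex $0$. After $n$ steps the vertex set is $\{0,1,\dots,n\}$. In step $n+1$ two (not necessarily different) vertices $u,v\in\{0,\dots,n\}$ are chosen independently and uniformly at random, independently of all earlier steps; a new vertex $w=n+1$ is added and connected to $u$ and to all neighbours of $u$ (duplication). In \emph{version 1}, all edges of $v$ are then deleted, except that the edge $vw$, if present, is kept. In \emph{version 2}, all edges of $v$ are deleted without exception. Couple the two versions by using the same $u,v$ in every step, and call an edge of version 1 \emph{red} if it is not an edge of version 2 at the same time. Vertices are coloured as follows; at the start the only vertex is black. In the duplication part of a step, the new vertex $w$ becomes red if $u$ is red, and black otherwise. Then, in the erasure part, if $v$ and $w$ are joined by an edge in version 1 (this edge is saved in version 1 and deleted in version 2, so it is red after the step), both $v$ and $w$ become red; otherwise $v$ has lost all its edges and becomes black. All other vertices keep their colour. \textbf{Proposition.} Let $S_n$ be the number of all edges (red or not) in version 1 after $n$ steps, and let $Z_n$ be the number of red vertices after $n$ steps. Then, almost surely, as $n\to\infty$, \[ S_n\sim n ,\qquad\text{and}\qquad Z_n=O\bigl(\log^{1+\varepsilon} n\bigr)\ \text{ for every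 } \varepsilon>0 . \] -/

import Mathlib

open Filter Asymptotics MeasureTheory ProbabilityTheory

namespace DupGraph

/-- The two old vertices selected in each step. After `n` steps the vertices are `0, …, n`;
in step `n + 1` the vertex `(c n).1` is duplicated, then `(c n).2` is selected for erasure,
and `n + 1` is the new vertex. -/
abbrev Choices : Type := (n : ℕ) → Fin (n + 1) × Fin (n + 1)

/-- Duplication: the vertex `a` gets connected to `u` and to all neighbours of `u`. -/
def duplicate (G : SimpleGraph ℕ) (u a : ℕ) : SimpleGraph ℕ :=
  G ⊔ SimpleGraph.fromRel (fun x y => x = a ∧ (y = u ∨ G.Adj u y))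

/-- The graph of version 1 after `n` steps: in the erasure part all edges of the vertex
`(c n).2` are deleted, except a possible edge to the new vertex `n + 1`. -/
def version1 (c : Choices) : ℕ → SimpleGraph ℕ
  | 0 => ⊥
  | n + 1 =>
    let G := duplicate (version1 c n) (c n).1 (n + 1)
    G.deleteEdges (G.incidenceSet (c n).2 \ {s(((c n).2 : ℕ), n + 1)})

/-- The graph of version 2 after `n` steps: in the erasure part all edges of the vertex
`(c n).2` are deleted without exceptions. -/
def version2 (c : Choices) : ℕ → SimpleGraph ℕ
  | 0 => ⊥
  | n + 1 =>
    let H := duplicate (version2 c n) (c n).1 (n + 1)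
    H.deleteEdges (H.incidenceSet (c n).2)

/-- The red edges after `n` steps: the edges that are present in version 1, but not in
version 2 run with the same selected vertices. -/
def redEdges (c : Choices) (n : ℕ) : SimpleGraph ℕ := version1 c n \ version2 c n

open Classical in
/-- The red vertices after `n` steps. In the duplication part the new vertex becomes red if and
only if the duplicated vertex is red. Then, if the new vertex and the vertex selected for erasure
are joined by a (saved, hence red) edge, both of them become red; otherwise the vertex selected
for erasure has lost all its edges and becomes black. -/
noncomputable def redVertices (c : Choices) : ℕ → Finset ℕ
  | 0 => ∅
  | n + 1 =>
    let R := if ((c n).1 : ℕ) ∈ redVertices c n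
      then insert (n + 1) (redVertices c n) else redVertices c n
    if (redEdges c (n + 1)).Adj (c n).2 (n + 1)
      then insert ((c n).2 : ℕ) (insert (n + 1) R) else R.erase (c n).2

/-- The number `S n` of edges (red or not) of version 1 after `n` steps. -/
noncomputable def numEdges (c : Choices) (n : ℕ) : ℕ := (version1 c n).edgeSet.ncard

/-- The number `Z n` of red vertices after `n` steps. -/
noncomputable def numRed (c : Choices) (n : ℕ) : ℕ := (redVertices c n).card

/-- In all steps the two old vertices are selected uniformly at random, with replacement,
independently of each other and of the other steps. -/
structure IsUniformChoice {Ω : Type*} [MeasurableSpace Ω] (μ : Measure Ω)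
    (c : (n : ℕ) → Ω → Fin (n + 1) × Fin (n + 1)) : Prop where
  measurable : ∀ n, Measurable (c n)
  law : ∀ n, μ.map (c n) =
    (uniformOn (Set.univ : Set (Fin (n + 1)))).prod (uniformOn (Set.univ : Set (Fin (n + 1))))
  indep : iIndepFun c μ

/-- All edges of version 1 after `n` steps join vertices among `0, …, n`. -/
theorem le_of_version1_adj (c : Choices) (n : ℕ) :
    ∀ x y : ℕ, (version1 c n).Adj x y → x ≤ n ∧ y ≤ n := by
  induction n with
  | zero => intro x y h; simp [version1] at h
  | succ n ih =>
    intro x y h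
    have hu := (c n).1.isLt
    have h' : (duplicate (version1 c n) (c n).1 (n + 1)).Adj x y := by
      simp only [version1] at h
      exact (SimpleGraph.deleteEdges_adj.1 h).1
    simp only [duplicate, SimpleGraph.sup_adj, SimpleGraph.fromRel_adj] at h'
    rcases h' with h' | ⟨-, ⟨rfl, rfl | h'⟩ | ⟨rfl, rfl | h'⟩⟩
    · have := ih _ _ h'; omega
    · omega
    · have := ih _ _ h'; omega
    · omega
    · have := ih _ _ h'; omega

/-- The edge set of version 1 is finite, so that `numEdges` is its true cardinality. -/
theorem finite_edgeSet_version1 (c : Choices) (n : ℕ) : (version1 c n).edgeSet.Finite := by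
  refine (((Set.finite_Iic n).prod (Set.finite_Iic n)).image (fun p => s(p.1, p.2))).subset ?_
  intro e
  induction e with
  | h x y =>
    intro h
    exact ⟨(x, y), le_of_version1_adj c n x y h, rfl⟩

end DupGraph

/-! Write `u`, `v` for the vertices duplicated and erased. The new vertex gets degree `1 + deg u`,
and its edges all survive; the other edges of `v` vanish. Hence `S` grows by `1 + deg u - deg v`.
Since `u` and `v` have the same law, every difference `g u - g v` has conditional mean zero, and
three estimates follow. `S n - n` is a martingale, and the conditional mean of its squared increment
is at most `4 * degSq / (n + 1)`. The sum of squared degrees has conditional drift at most `2 + 12 *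
S n / (n + 1)`, so its expectation is at most `14 * n`, and the squared deviation has expected drift
at most 56. The number of red vertices changes by at most `1[u red] - 1[v red]`, plus 2 if `v` is
`u` or a neighbour of `u`. Its expected drift is thus at most `6 / (n + 1)`. Expectations become
almost sure bounds through `ae_le_mul_of_stepMean_le`: dividing by increasing weights `L n` that
make the expected drifts summable gives an almost supermartingale, which is almost surely bounded.
The weights are `(n + 1) ^ (3 / 2)`, which is `o(n ^ 2)`, and `log (n + 3) ^ p` with `p > 1`. -/

namespace DupGraph

/-! ### Averaging over one step and martingale convergence -/

/-- The mean of `f` over the choice made in step `n + 1`, the other choices being fixed. -/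
noncomputable def stepMean (n : ℕ) (f : Choices → ℝ) (c : Choices) : ℝ :=
  (∑ p : Fin (n + 1) × Fin (n + 1), f (Function.update c n p)) / ((n : ℝ) + 1) ^ 2

theorem stepMean_mono {n : ℕ} {f g : Choices → ℝ} {c : Choices}
    (h : ∀ p, f (Function.update c n p) ≤ g (Function.update c n p)) :
    stepMean n f c ≤ stepMean n g c := by
  unfold stepMean
  gcongr with p
  exact h p

theorem stepMean_of_dependsOn {n : ℕ} {f : Choices → ℝ} (hf : DependsOn f (Set.Iio n))
    (c : Choices) : stepMean n f c = f c := by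
  have h : ∀ p, f (Function.update c n p) = f c := fun p => hf fun k hk =>
    Function.update_of_ne (ne_of_lt hk) _ _
  have : ((n : ℝ) + 1) ≠ 0 := by positivity
  simp only [stepMean, h, Finset.sum_const, Finset.card_univ, Fintype.card_prod, Fintype.card_fin,
    nsmul_eq_mul]
  push_cast
  field_simp

theorem dependsOn_stepMean {n : ℕ} {f : Choices → ℝ} (hf : DependsOn f (Set.Iio (n + 1))) :
    DependsOn (stepMean n f) (Set.Iio n) := by
  intro c c' h
  simp only [DupGraph.stepMean]
  congr 1
  refine Finset.sum_congr rfl fun p _ => hf fun k hk => ?_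
  rcases Nat.lt_succ_iff_lt_or_eq.1 hk with hk | rfl
  · rw [Function.update_of_ne hk.ne, Function.update_of_ne hk.ne, h k hk]
  · simp

/-- The choices in the first `n` steps. -/
def firstChoices (n : ℕ) (c : Choices) :
    (i : Finset.range n) → Fin ((i : ℕ) + 1) × Fin ((i : ℕ) + 1) :=
  fun i => c i

/-- Extends finitely many choices to an infinite sequence. -/
def extend (n : ℕ) (h : (i : Finset.range n) → Fin ((i : ℕ) + 1) × Fin ((i : ℕ) + 1)) : Choices :=
  fun k => if hk : k ∈ Finset.range n then h ⟨k, hk⟩ else (0, 0)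

theorem extend_firstChoices {n k : ℕ} (hk : k < n) (c : Choices) :
    extend n (firstChoices n c) k = c k := by
  simp [extend, firstChoices, hk]

section expectation
variable {Ω : Type*} [mΩ : MeasurableSpace Ω] {μ : Measure Ω}
  {c : (n : ℕ) → Ω → Fin (n + 1) × Fin (n + 1)}

theorem measurable_firstChoices (hc : ∀ n, Measurable (c n)) (n : ℕ) :
    Measurable fun ω => firstChoices n fun k => c k ω :=
  measurable_pi_lambda _ fun i => hc i

/-- The σ-algebras generated by the choices of the first steps. -/
def history (hc : ∀ n, Measurable (c n)) : Filtration ℕ mΩ where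
  seq n := MeasurableSpace.comap (fun ω => firstChoices n fun k => c k ω) inferInstance
  mono' := by
    intro m n hmn
    have : (fun ω => firstChoices m fun k => c k ω) =
        (fun h => firstChoices m (extend n h)) ∘ fun ω => firstChoices n fun k => c k ω := by
      funext ω i
      have := Finset.mem_range.1 i.2
      exact (extend_firstChoices (this.trans_le hmn) fun k => c k ω).symm
    simp only
    rw [this, ← MeasurableSpace.comap_comp]
    exact MeasurableSpace.comap_mono (measurable_of_finite _).comap_le
  le' n := (measurable_firstChoices hc n).comap_le

/-- Such a function factors through the finite type of the first `n` choices, on which everything is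
measurable. The default values in `extend` play no role. -/
theorem measurable_history_of_dependsOn (hc : ∀ n, Measurable (c n)) {n : ℕ} {f : Choices → ℝ}
    (hf : DependsOn f (Set.Iio n)) :
    Measurable[history hc n] fun ω => f fun k => c k ω := by
  have : (fun ω => f fun k => c k ω) =
      (fun h => f (extend n h)) ∘ fun ω => firstChoices n fun k => c k ω := by
    funext ω
    exact (hf fun k hk => extend_firstChoices hk fun k => c k ω).symm
  rw [this]
  exact (measurable_of_finite _).comp (comap_measurable _)

theorem integrable_of_dependsOn [IsFiniteMeasure μ] (hc : ∀ n, Measurable (c n)) {n : ℕ}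
    {f : Choices → ℝ} (hf : DependsOn f (Set.Iio n)) :
    Integrable (fun ω => f fun k => c k ω) μ := by
  have : (fun ω => f fun k => c k ω) =
      (fun h => f (extend n h)) ∘ fun ω => firstChoices n fun k => c k ω := by
    funext ω
    exact (hf fun k hk => extend_firstChoices hk fun k => c k ω).symm
  rw [this]
  exact Integrable.comp_measurable .of_finite (measurable_firstChoices hc n)

theorem integral_uniformOn_prod (n : ℕ) (F : Fin (n + 1) × Fin (n + 1) → ℝ) :
    ∫ p, F p ∂((uniformOn (Set.univ : Set (Fin (n + 1)))).prod
      (uniformOn (Set.univ : Set (Fin (n + 1))))) = (∑ p, F p) / ((n : ℝ) + 1) ^ 2 := by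
  have : IsProbabilityMeasure (uniformOn (Set.univ : Set (Fin (n + 1)))) :=
    isProbabilityMeasure_uniformOn Set.finite_univ Set.univ_nonempty
  rw [integral_fintype .of_finite, Finset.sum_div]
  refine Finset.sum_congr rfl fun p _ => ?_
  have h : ∀ x : Fin (n + 1), (uniformOn (Set.univ : Set (Fin (n + 1)))).real {x}
      = ((n : ℝ) + 1)⁻¹ := by
    intro x
    rw [measureReal_def, uniformOn_univ]
    simp
    norm_cast
  obtain ⟨x, y⟩ := p
  rw [← Set.singleton_prod_singleton, measureReal_prod_prod, h, h, smul_eq_mul]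
  field_simp

/-- Averaging out the choice of the last step does not change the expectation. -/
theorem integral_stepMean [IsProbabilityMeasure μ] (hc : IsUniformChoice μ c) {n : ℕ}
    {f : Choices → ℝ} (hf : DependsOn f (Set.Iio (n + 1))) :
    ∫ ω, stepMean n f (fun k => c k ω) ∂μ = ∫ ω, f (fun k => c k ω) ∂μ := by
  set H : Ω → _ := fun ω => firstChoices n fun k => c k ω with hH
  have hHm : Measurable H := measurable_firstChoices hc.measurable n
  -- By independence the joint law of the past and the present choice is a product, so Fubini
  -- applies below.
  have hind : IndepFun H (c n) μ := by
    have h := hc.indep.indepFun_finset (Finset.range n) {n} (by simp) hc.measurable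
    exact h.comp (φ := id) (ψ := fun q => q ⟨n, by simp⟩) measurable_id (measurable_of_finite _)
  set F : ((i : Finset.range n) → Fin ((i : ℕ) + 1) × Fin ((i : ℕ) + 1)) →
    Fin (n + 1) × Fin (n + 1) → ℝ := fun h p => f (Function.update (extend n h) n p) with hF
  have key : ∀ ω p, f (Function.update (fun k => c k ω) n p) = F (H ω) p := by
    intro ω p
    refine hf fun k hk => ?_
    rcases Nat.lt_succ_iff_lt_or_eq.1 hk with hk | rfl
    · rw [Function.update_of_ne hk.ne, Function.update_of_ne hk.ne]
      exact (extend_firstChoices hk fun k => c k ω).symm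
    · simp
  have h1 : ∀ ω, f (fun k => c k ω) = F (H ω) (c n ω) := by
    intro ω
    rw [← key, Function.update_eq_self]
  have h2 : ∀ ω, stepMean n f (fun k => c k ω) = ∫ p, F (H ω) p ∂(μ.map (c n)) := by
    intro ω
    rw [hc.law, integral_uniformOn_prod]
    simp only [stepMean, key]
  have : IsProbabilityMeasure (μ.map H) := Measure.isProbabilityMeasure_map hHm.aemeasurable
  have : IsProbabilityMeasure (μ.map (c n)) :=
    Measure.isProbabilityMeasure_map (hc.measurable n).aemeasurable
  simp_rw [h1, h2]
  have hprod := (indepFun_iff_map_prod_eq_prod_map_map hHm.aemeasurable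
    (hc.measurable n).aemeasurable).1 hind
  calc ∫ ω, ∫ p, F (H ω) p ∂(μ.map (c n)) ∂μ
      = ∫ h, ∫ p, F h p ∂(μ.map (c n)) ∂(μ.map H) :=
        (integral_map hHm.aemeasurable (measurable_of_finite
          (fun h => ∫ p, F h p ∂(μ.map (c n)))).aestronglyMeasurable).symm
    _ = ∫ z, F z.1 z.2 ∂((μ.map H).prod (μ.map (c n))) := by
        rw [integral_prod _ .of_finite]
    _ = ∫ ω, F (H ω) (c n ω) ∂μ := by
        rw [← hprod, integral_map (hHm.prodMk (hc.measurable n)).aemeasurable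
          (measurable_of_finite _).aestronglyMeasurable]

/-- The submartingale inequality is tested on events of the history. The indicator of such an event
depends on the first `n` choices only, so it passes through the average over step `n + 1`. -/
theorem submartingale_of_le_stepMean [IsProbabilityMeasure μ] (hc : IsUniformChoice μ c)
    {f : ℕ → Choices → ℝ} (hf : ∀ n, DependsOn (f n) (Set.Iio n))
    (hle : ∀ n c, f n c ≤ stepMean n (f (n + 1)) c) :
    Submartingale (fun n ω => f n fun k => c k ω) (history hc.measurable) μ := by
  refine submartingale_of_setIntegral_le_succ
    (fun n => (measurable_history_of_dependsOn hc.measurable (hf n)).stronglyMeasurable)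
    (fun n => integrable_of_dependsOn hc.measurable (hf n)) fun n s hs => ?_
  obtain ⟨B, -, rfl⟩ := hs
  have hsm : MeasurableSet ((fun ω => firstChoices n fun k => c k ω) ⁻¹' B) :=
    measurable_firstChoices hc.measurable n (Set.toFinite B).measurableSet
  set T : Set Choices := firstChoices n ⁻¹' B
  have hT : ∀ a b : Choices, (∀ k ∈ Set.Iio n, a k = b k) → (a ∈ T ↔ b ∈ T) := by
    intro a b h
    have : firstChoices n a = firstChoices n b :=
      funext fun i => h i (Finset.mem_range.1 i.2)
    simp only [T, Set.mem_preimage, this]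
  have hind : ∀ m, n ≤ m → ∀ g : Choices → ℝ, DependsOn g (Set.Iio m) →
      DependsOn (T.indicator g) (Set.Iio m) := by
    intro m hm g hg a b h
    have h' := hT a b fun k hk => h k (lt_of_lt_of_le hk hm)
    by_cases ha : a ∈ T
    · rw [Set.indicator_of_mem ha, Set.indicator_of_mem (h'.1 ha), hg h]
    · rw [Set.indicator_of_notMem ha, Set.indicator_of_notMem fun hb => ha (h'.2 hb)]
  have hset : ∀ g : Choices → ℝ,
      ∫ ω in (fun ω => firstChoices n fun k => c k ω) ⁻¹' B, g (fun k => c k ω) ∂μ =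
        ∫ ω, T.indicator g (fun k => c k ω) ∂μ := by
    intro g
    rw [← integral_indicator hsm]
    rfl
  rw [hset, hset, ← integral_stepMean hc (hind _ n.le_succ _ (hf _))]
  refine integral_mono (integrable_of_dependsOn hc.measurable (hind n le_rfl _ (hf n)))
    (integrable_of_dependsOn hc.measurable (dependsOn_stepMean (hind _ n.le_succ _ (hf _))))
    fun ω => ?_
  have h' : ∀ p, Function.update (fun k => c k ω) n p ∈ T ↔ (fun k => c k ω) ∈ T := fun p =>
    hT _ _ fun k hk => Function.update_of_ne (ne_of_lt hk) _ _
  by_cases hω : (fun k => c k ω) ∈ T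
  · simp only [Set.indicator_of_mem hω]
    refine (hle n _).trans (stepMean_mono fun p => ?_)
    rw [Set.indicator_of_mem ((h' p).2 hω)]
  · simp only [Set.indicator_of_notMem hω, stepMean]
    refine div_nonneg (Finset.sum_nonneg fun p _ => ?_) (by positivity)
    rw [Set.indicator_of_notMem fun h => hω ((h' p).1 h)]

theorem ae_tendsto_of_integral_abs_le [IsProbabilityMeasure μ] (hc : IsUniformChoice μ c)
    {f : ℕ → Choices → ℝ} (hf : ∀ n, DependsOn (f n) (Set.Iio n))
    (hle : ∀ n c, f n c ≤ stepMean n (f (n + 1)) c) {R : ℝ}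
    (hR : ∀ n, ∫ ω, |f n fun k => c k ω| ∂μ ≤ R) :
    ∀ᵐ ω ∂μ, ∃ l, Tendsto (fun n => f n fun k => c k ω) atTop (nhds l) := by
  refine (submartingale_of_le_stepMean hc hf hle).exists_ae_tendsto_of_bdd (R := R.toNNReal)
    fun n => ?_
  rw [eLpNorm_one_eq_lintegral_enorm,
    ← ofReal_integral_norm_eq_lintegral_enorm (integrable_of_dependsOn hc.measurable (hf n))]
  exact ENNReal.ofReal_le_ofReal (hR n)

/-- A nonnegative process whose conditional means grow by at most `a n` is almost surely bounded,
if the expectations of the `a n` are summable. -/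
theorem ae_bddAbove_of_stepMean_le [IsProbabilityMeasure μ] (hc : IsUniformChoice μ c)
    {X a : ℕ → Choices → ℝ} {b : ℕ → ℝ}
    (hX : ∀ n, DependsOn (X n) (Set.Iio n)) (ha : ∀ n, DependsOn (a n) (Set.Iio n))
    (hX0 : ∀ n c, 0 ≤ X n c) (ha0 : ∀ n c, 0 ≤ a n c)
    (hle : ∀ n c, stepMean n (X (n + 1)) c ≤ X n c + a n c)
    (hb : ∀ n, ∫ ω, a n (fun k => c k ω) ∂μ ≤ b n) (hs : Summable b) :
    ∀ᵐ ω ∂μ, ∃ C, ∀ n, X n (fun k => c k ω) ≤ C := by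
  have iX := fun n => integrable_of_dependsOn (μ := μ) hc.measurable (hX n)
  have ia := fun n => integrable_of_dependsOn (μ := μ) hc.measurable (ha n)
  have hb0 : ∀ n, 0 ≤ b n := fun n => (integral_nonneg fun ω => ha0 n _).trans (hb n)
  -- Both `A` and `A - X` are submartingales bounded in L¹, so both converge almost surely, and
  -- hence so does `X`.
  set A : ℕ → Choices → ℝ := fun n c => ∑ k ∈ Finset.range n, a k c with hA
  have hA0 : ∀ n c, 0 ≤ A n c := fun n c => Finset.sum_nonneg fun k _ => ha0 k c
  have dA : ∀ n, DependsOn (A n) (Set.Iio n) := by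
    intro n x y h
    exact Finset.sum_congr rfl fun k hk =>
      ha k fun j hj => h j (lt_trans hj (Finset.mem_range.1 hk))
  -- Predictability: `A (n + 1)` is fixed by the first `n` choices, so averaging over step `n + 1`
  -- leaves it unchanged.
  have dA' : ∀ n, DependsOn (A (n + 1)) (Set.Iio n) := by
    intro n x y h
    exact Finset.sum_congr rfl fun k hk =>
      ha k fun j hj => h j (lt_of_lt_of_le hj (Nat.lt_succ_iff.1 (Finset.mem_range.1 hk)))
  have iA := fun n => integrable_of_dependsOn (μ := μ) hc.measurable (dA n)
  have EA : ∀ n, ∫ ω, A n (fun k => c k ω) ∂μ ≤ ∑' k, b k := by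
    intro n
    simp only [hA]
    rw [integral_finsetSum _ fun k _ => ia k]
    exact (Finset.sum_le_sum fun k _ => hb k).trans
      (hs.sum_le_tsum _ fun k _ => hb0 k)
  have EX : ∀ n, ∫ ω, X n (fun k => c k ω) ∂μ ≤
      ∫ ω, X 0 (fun k => c k ω) ∂μ + ∑ k ∈ Finset.range n, b k := by
    intro n
    induction n with
    | zero => simp
    | succ n ih =>
      rw [← integral_stepMean hc (hX (n + 1)), Finset.sum_range_succ]
      have := integral_mono (integrable_of_dependsOn (μ := μ) hc.measurable
        (dependsOn_stepMean (hX (n + 1)))) ((iX n).add (ia n)) fun ω => hle n _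
      have h2 := integral_add (iX n) (ia n)
      simp only [Pi.add_apply] at this
      linarith [hb n]
  have cA := ae_tendsto_of_integral_abs_le hc dA (fun n x => by
    have h : stepMean n (A (n + 1)) x = A (n + 1) x := stepMean_of_dependsOn (dA' n) x
    rw [h]
    simp only [hA, Finset.sum_range_succ]
    linarith [ha0 n x]) (R := ∑' k, b k) fun n => by
      simpa only [abs_of_nonneg (hA0 n _)] using EA n
  have cX := ae_tendsto_of_integral_abs_le hc (f := fun n x => A n x - X n x)
    (fun n x y h => by simp only [dA n h, hX n h]) (fun n x => by
    have h : stepMean n (A (n + 1)) x = A (n + 1) x := stepMean_of_dependsOn (dA' n) x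
    have h2 : stepMean n (fun x => A (n + 1) x - X (n + 1) x) x =
        stepMean n (A (n + 1)) x - stepMean n (X (n + 1)) x := by
      simp only [stepMean, Finset.sum_sub_distrib, sub_div]
    rw [h2, h]
    have := hle n x
    simp only [hA, Finset.sum_range_succ] at *
    linarith) (R := ∫ ω, X 0 (fun k => c k ω) ∂μ + ∑' k, b k + ∑' k, b k) fun n => by
      have h1 : ∫ ω, |A n (fun k => c k ω) - X n (fun k => c k ω)| ∂μ ≤
          ∫ ω, (A n (fun k => c k ω) + X n (fun k => c k ω)) ∂μ := by
        refine integral_mono ((iA n).sub (iX n)).abs ((iA n).add (iX n)) fun ω => ?_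
        have := hA0 n fun k => c k ω
        have := hX0 n fun k => c k ω
        simp only
        rw [abs_le]
        constructor <;> linarith
      rw [integral_add (iA n) (iX n)] at h1
      have := EA n
      have := EX n
      have := hs.sum_le_tsum (Finset.range n) fun k _ => hb0 k
      linarith
  filter_upwards [cA, cX] with ω ⟨l, hl⟩ ⟨l', hl'⟩
  have := hl.sub hl'
  simp only [sub_sub_cancel] at this
  obtain ⟨C, hC⟩ := this.bddAbove_range
  exact ⟨C, fun n => hC ⟨n, rfl⟩⟩

end expectation

/-! ### Dependence on past choices; adjacency and degrees -/

theorem version1_congr {c c' : Choices} {n : ℕ} (h : ∀ k < n, c k = c' k) :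
    version1 c n = version1 c' n := by
  induction n with
  | zero => rfl
  | succ n ih =>
    simp only [version1, ih fun k hk => h k (hk.trans n.lt_succ_self), h n n.lt_succ_self]

theorem version2_congr {c c' : Choices} {n : ℕ} (h : ∀ k < n, c k = c' k) :
    version2 c n = version2 c' n := by
  induction n with
  | zero => rfl
  | succ n ih =>
    simp only [version2, ih fun k hk => h k (hk.trans n.lt_succ_self), h n n.lt_succ_self]

theorem fst_le (c : Choices) (n : ℕ) : ((c n).1 : ℕ) ≤ n := Nat.lt_succ_iff.1 (c n).1.isLt

theorem snd_le (c : Choices) (n : ℕ) : ((c n).2 : ℕ) ≤ n := Nat.lt_succ_iff.1 (c n).2.isLt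

theorem redVertices_congr {c c' : Choices} {n : ℕ} (h : ∀ k < n, c k = c' k) :
    redVertices c n = redVertices c' n := by
  induction n with
  | zero => rfl
  | succ n ih =>
    have hr : redEdges c (n + 1) = redEdges c' (n + 1) := by
      simp only [redEdges, version1_congr h, version2_congr h]
    simp only [redVertices, ih fun k hk => h k (hk.trans n.lt_succ_self), h n n.lt_succ_self]
    classical
    exact if_congr (by rw [hr, h n n.lt_succ_self]) rfl rfl

open Classical in
/-- The adjacency matrix of version 1. -/
noncomputable def adj (c : Choices) (n x y : ℕ) : ℝ := if (version1 c n).Adj x y then 1 else 0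

/-- The degree of a vertex in version 1. -/
noncomputable def deg (c : Choices) (n x : ℕ) : ℝ := ∑ y ∈ Finset.range (n + 1), adj c n x y

/-- The sum of the squares of the degrees in version 1. -/
noncomputable def degSq (c : Choices) (n : ℕ) : ℝ := ∑ x ∈ Finset.range (n + 1), deg c n x ^ 2

/-- The indicator of the closed neighbourhood of the vertex duplicated in step `n + 1`. -/
noncomputable def nbhd (c : Choices) (n x : ℕ) : ℝ :=
  (if x = ((c n).1 : ℕ) then 1 else 0) + adj c n (c n).1 x

section congr
variable {c c' : Choices} {n : ℕ} (h : ∀ k < n, c k = c' k)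
include h

theorem adj_congr (x y : ℕ) : adj c n x y = adj c' n x y := by
  classical
  exact if_congr (by rw [version1_congr h]) rfl rfl

theorem deg_congr (x : ℕ) : deg c n x = deg c' n x := by
  simp only [deg, adj_congr h]

theorem degSq_congr : degSq c n = degSq c' n := by
  simp only [degSq, deg_congr h]

theorem numEdges_congr : numEdges c n = numEdges c' n := by
  simp only [numEdges, version1_congr h]

theorem numRed_congr : numRed c n = numRed c' n := by
  simp only [numRed, redVertices_congr h]

end congr

theorem adj_nonneg (c : Choices) (n x y : ℕ) : 0 ≤ adj c n x y := by
  unfold adj; split_ifs <;> norm_num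

theorem adj_mul_self (c : Choices) (n x y : ℕ) : adj c n x y * adj c n x y = adj c n x y := by
  unfold adj; split_ifs <;> norm_num

theorem adj_comm (c : Choices) (n x y : ℕ) : adj c n x y = adj c n y x := by
  classical
  exact if_congr (SimpleGraph.adj_comm _ _ _) rfl rfl

theorem adj_self (c : Choices) (n x : ℕ) : adj c n x x = 0 := by
  simp [adj]

theorem deg_nonneg (c : Choices) (n x : ℕ) : 0 ≤ deg c n x :=
  Finset.sum_nonneg fun _ _ => adj_nonneg _ _ _ _

theorem degSq_nonneg (c : Choices) (n : ℕ) : 0 ≤ degSq c n :=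
  Finset.sum_nonneg fun _ _ => sq_nonneg _

theorem nbhd_nonneg (c : Choices) (n x : ℕ) : 0 ≤ nbhd c n x :=
  add_nonneg (by split_ifs <;> norm_num) (adj_nonneg _ _ _ _)

theorem nbhd_mul_self (c : Choices) (n x : ℕ) : nbhd c n x * nbhd c n x = nbhd c n x := by
  unfold nbhd
  split_ifs with h
  · rw [h, adj_self]; norm_num
  · rw [zero_add, adj_mul_self]

theorem sum_nbhd (c : Choices) (n : ℕ) :
    ∑ x ∈ Finset.range (n + 1), nbhd c n x = 1 + deg c n (c n).1 := by
  simp only [nbhd, Finset.sum_add_distrib, deg]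
  rw [Finset.sum_ite_eq' (Finset.range (n + 1)) ((c n).1 : ℕ) fun _ => (1 : ℝ)]
  simp [fst_le]

/-! ### One step of version 1: edges and degrees -/

theorem version1_succ_adj_old {c : Choices} {n x y : ℕ} (hx : x ≤ n) (hy : y ≤ n) :
    (version1 c (n + 1)).Adj x y ↔
      (version1 c n).Adj x y ∧ x ≠ ((c n).2 : ℕ) ∧ y ≠ ((c n).2 : ℕ) := by
  have hx' : x ≠ n + 1 := by omega
  have hy' : y ≠ n + 1 := by omega
  have hD : (duplicate (version1 c n) (c n).1 (n + 1)).Adj x y ↔ (version1 c n).Adj x y := by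
    simp [duplicate, SimpleGraph.fromRel_adj, hx', hy']
  simp only [version1, SimpleGraph.deleteEdges_adj, hD]
  by_cases h : (version1 c n).Adj x y
  · have hv : ((c n).2 : ℕ) ≠ n + 1 := by have := (c n).2.isLt; omega
    simp only [Set.mem_sdiff, SimpleGraph.incidenceSet, Set.mem_sep_iff,
      SimpleGraph.mem_edgeSet, hD, h, Sym2.mem_iff, Set.mem_singleton_iff, Sym2.eq_iff, hx', hy']
    simp
    grind
  · simp [h]

theorem duplicate_adj_new {c : Choices} {n x : ℕ} (hx : x ≤ n) :
    (duplicate (version1 c n) (c n).1 (n + 1)).Adj x (n + 1) ↔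
      x = ((c n).1 : ℕ) ∨ (version1 c n).Adj (c n).1 x := by
  have hx' : x ≠ n + 1 := by omega
  have h1 : ¬ (version1 c n).Adj x (n + 1) := fun h => by
    have := le_of_version1_adj c n _ _ h; omega
  simp [duplicate, SimpleGraph.fromRel_adj, hx', h1]

/-- The only edge at the new vertex that the erasure could remove is the one to `v`, and version 1
exempts it. -/
theorem version1_succ_adj_new {c : Choices} {n x : ℕ} (hx : x ≤ n) :
    (version1 c (n + 1)).Adj x (n + 1) ↔
      x = ((c n).1 : ℕ) ∨ (version1 c n).Adj (c n).1 x := by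
  have hv : ((c n).2 : ℕ) ≠ n + 1 := by have := (c n).2.isLt; omega
  simp only [version1, SimpleGraph.deleteEdges_adj, duplicate_adj_new hx, and_iff_left_iff_imp]
  rintro - ⟨⟨-, h⟩, h'⟩
  simp only [Sym2.mem_iff, hv, or_false] at h
  exact h' (by rw [h]; rfl)

theorem adj_succ_old {c : Choices} {n x y : ℕ} (hx : x ≤ n) (hy : y ≤ n) :
    adj c (n + 1) x y = if x = ((c n).2 : ℕ) ∨ y = ((c n).2 : ℕ) then 0 else adj c n x y := by
  have h := version1_succ_adj_old (c := c) hx hy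
  simp only [adj]
  grind

theorem adj_succ_new {c : Choices} {n x : ℕ} (hx : x ≤ n) :
    adj c (n + 1) x (n + 1) = nbhd c n x := by
  have hw := version1_succ_adj_new (c := c) hx
  simp only [adj, nbhd]
  by_cases h : x = ((c n).1 : ℕ)
  · rw [if_pos (hw.2 (Or.inl h)), if_pos h, if_neg (by rw [h]; exact SimpleGraph.irrefl _), add_zero]
  · rw [if_neg h, zero_add]
    classical
    exact if_congr (by rw [hw, or_iff_right h]) rfl rfl

theorem deg_succ_new (c : Choices) (n : ℕ) : deg c (n + 1) (n + 1) = 1 + deg c n (c n).1 := by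
  rw [← sum_nbhd, deg, Finset.sum_range_succ, adj_self, add_zero]
  refine Finset.sum_congr rfl fun x hx => ?_
  rw [adj_comm, adj_succ_new (Nat.lt_succ_iff.1 (Finset.mem_range.1 hx))]

theorem deg_succ_erased (c : Choices) (n : ℕ) :
    deg c (n + 1) (c n).2 = nbhd c n (c n).2 := by
  have hv := Nat.lt_succ_iff.1 (c n).2.isLt
  rw [deg, Finset.sum_range_succ, adj_succ_new hv, Finset.sum_eq_zero, zero_add]
  intro y hy
  rw [adj_succ_old hv (Nat.lt_succ_iff.1 (Finset.mem_range.1 hy))]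
  simp

theorem deg_succ_of_ne {c : Choices} {n x : ℕ} (hx : x ≤ n) (hxv : x ≠ ((c n).2 : ℕ)) :
    deg c (n + 1) x = deg c n x - adj c n x (c n).2 + nbhd c n x := by
  rw [deg, Finset.sum_range_succ, adj_succ_new hx]
  congr 1
  rw [deg, eq_sub_iff_add_eq]
  have : adj c n x (c n).2 = ∑ y ∈ Finset.range (n + 1),
      if y = ((c n).2 : ℕ) then adj c n x y else 0 := by
    rw [Finset.sum_ite_eq']
    simp [snd_le]
  rw [this, ← Finset.sum_add_distrib]
  refine Finset.sum_congr rfl fun y hy => ?_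
  rw [adj_succ_old hx (Nat.lt_succ_iff.1 (Finset.mem_range.1 hy))]
  by_cases h : y = ((c n).2 : ℕ) <;> simp [h, hxv]

theorem sum_ite_erased (c : Choices) (n : ℕ) (f : ℕ → ℝ) :
    ∑ x ∈ Finset.range (n + 1), (if x = ((c n).2 : ℕ) then f x else 0) = f (c n).2 := by
  rw [Finset.sum_ite_eq']
  simp [snd_le]

theorem sum_adj_erased (c : Choices) (n : ℕ) (x : ℕ) :
    ∑ y ∈ Finset.range (n + 1), adj c n y x = deg c n x := by
  simp only [adj_comm c n _ x, deg]

theorem sum_deg_succ (c : Choices) (n : ℕ) :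
    ∑ x ∈ Finset.range (n + 2), deg c (n + 1) x =
      ∑ x ∈ Finset.range (n + 1), deg c n x + 2 + 2 * deg c n (c n).1 - 2 * deg c n (c n).2 := by
  rw [Finset.sum_range_succ, deg_succ_new]
  -- At the erased vertex the formula for the other vertices is too large by the old degree; the
  -- last term corrects this.
  have : ∀ x ∈ Finset.range (n + 1), deg c (n + 1) x = deg c n x - adj c n x (c n).2 + nbhd c n x
      - if x = ((c n).2 : ℕ) then deg c n x else 0 := by
    intro x hx
    split_ifs with h
    · rw [h, deg_succ_erased, adj_self]; ring
    · rw [deg_succ_of_ne (Nat.lt_succ_iff.1 (Finset.mem_range.1 hx)) h, sub_zero]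
  rw [Finset.sum_congr rfl this, Finset.sum_sub_distrib, Finset.sum_add_distrib,
    Finset.sum_sub_distrib, sum_nbhd, sum_adj_erased, sum_ite_erased]
  ring

theorem sum_deg_eq (c : Choices) (n : ℕ) :
    ∑ x ∈ Finset.range (n + 1), deg c n x = 2 * numEdges c n := by
  classical
  set r := Finset.range (n + 1)
  have h1 : numEdges c n = ((r ×ˢ r).filter fun p => p.1 < p.2 ∧ (version1 c n).Adj p.1 p.2).card := by
    rw [numEdges, ← Set.ncard_coe_finset]
    symm
    refine Set.ncard_congr (fun p _ => s(p.1, p.2)) ?_ ?_ ?_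
    · intro p hp
      simp only [Finset.coe_filter, Set.mem_ofPred_eq] at hp
      exact hp.2.2
    · rintro ⟨a, b⟩ ⟨a', b'⟩ h h' he
      simp only [Finset.coe_filter, Set.mem_ofPred_eq, Sym2.eq_iff] at h h' he
      rcases he with ⟨rfl, rfl⟩ | ⟨rfl, rfl⟩
      · rfl
      · omega
    · intro e
      induction e with
      | h x y =>
        intro he
        have he : (version1 c n).Adj x y := he
        have hle := le_of_version1_adj c n _ _ he
        rcases lt_or_gt_of_ne he.ne with h | h
        · refine ⟨(x, y), ?_, rfl⟩
          simp [r, he, h]; omega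
        · refine ⟨(y, x), ?_, Sym2.eq_swap⟩
          simp [r, he.symm, h]; omega
  have h2 : (numEdges c n : ℝ) = ∑ x ∈ r, ∑ y ∈ r, if x < y then adj c n x y else 0 := by
    rw [h1, Finset.card_filter, Finset.sum_product]
    push_cast
    refine Finset.sum_congr rfl fun x _ => Finset.sum_congr rfl fun y _ => ?_
    simp only [adj]
    grind
  have h3 : (numEdges c n : ℝ) = ∑ x ∈ r, ∑ y ∈ r, if y < x then adj c n x y else 0 := by
    rw [h2, Finset.sum_comm]
    simp only [adj_comm c n]
  rw [two_mul]
  nth_rw 1 [h2]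
  rw [h3]
  simp only [deg, ← Finset.sum_add_distrib]
  refine Finset.sum_congr rfl fun x _ => Finset.sum_congr rfl fun y _ => ?_
  rcases lt_trichotomy x y with h | h | h
  · simp [h, h.le]
  · simp [h, adj_self]
  · simp [h, h.le]

theorem numEdges_succ (c : Choices) (n : ℕ) :
    (numEdges c (n + 1) : ℝ) = numEdges c n + 1 + deg c n (c n).1 - deg c n (c n).2 := by
  have h := sum_deg_succ c n
  have h1 := sum_deg_eq c (n + 1)
  have h2 := sum_deg_eq c n
  linarith

theorem numEdges_zero (c : Choices) : numEdges c 0 = 0 := by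
  simp [numEdges, version1]

theorem degSq_zero (c : Choices) : degSq c 0 = 0 := by
  simp [degSq, deg, adj_self]

/-- The part of the increment of `degSq` that has mean zero is a difference of values of this
function at the two selected vertices. -/
noncomputable def degWeight (c : Choices) (n x : ℕ) : ℝ :=
  deg c n x ^ 2 + 2 * ∑ y ∈ Finset.range (n + 1), deg c n y * adj c n y x

theorem sum_deg_mul_nbhd (c : Choices) (n : ℕ) :
    ∑ x ∈ Finset.range (n + 1), deg c n x * nbhd c n x = deg c n (c n).1 +
      ∑ x ∈ Finset.range (n + 1), deg c n x * adj c n x (c n).1 := by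
  simp only [nbhd, mul_add, Finset.sum_add_distrib, adj_comm c n _ ((c n).1 : ℕ), mul_ite, mul_one,
    mul_zero]
  rw [Finset.sum_ite_eq']
  simp [fst_le]

/-- The entries of `adj` and `nbhd` are 0 or 1, hence equal to their squares, and the mixed term `-2
* nbhd * adj` is dropped. Of the `5 * deg u`, two come from the square `(1 + deg u) ^ 2` of the new
degree, one from the sum of `nbhd`, two from `sum_deg_mul_nbhd`. -/
theorem degSq_succ_le (c : Choices) (n : ℕ) :
    degSq c (n + 1) ≤ degSq c n + degWeight c n (c n).1 - degWeight c n (c n).2 +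
      5 * deg c n (c n).1 + deg c n (c n).2 + 2 := by
  rw [degSq, Finset.sum_range_succ, deg_succ_new]
  have : ∀ x ∈ Finset.range (n + 1), deg c (n + 1) x ^ 2 ≤ deg c n x ^ 2 + adj c n x (c n).2 +
      nbhd c n x + 2 * (deg c n x * nbhd c n x) - 2 * (deg c n x * adj c n x (c n).2)
      - if x = ((c n).2 : ℕ) then deg c n x ^ 2 else 0 := by
    intro x hx
    have h1 := nbhd_mul_self c n x
    have h2 := adj_mul_self c n x (c n).2
    have h3 := mul_nonneg (nbhd_nonneg c n x) (adj_nonneg c n x (c n).2)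
    have h4 := mul_nonneg (deg_nonneg c n x) (nbhd_nonneg c n x)
    split_ifs with h
    · rw [h] at h1 h4 ⊢
      rw [deg_succ_erased, adj_self]
      nlinarith
    · rw [deg_succ_of_ne (Nat.lt_succ_iff.1 (Finset.mem_range.1 hx)) h]
      nlinarith
  refine (add_le_add_left (Finset.sum_le_sum this) _).trans ?_
  rw [Finset.sum_sub_distrib, Finset.sum_sub_distrib, Finset.sum_add_distrib,
    Finset.sum_add_distrib, Finset.sum_add_distrib, ← Finset.mul_sum, ← Finset.mul_sum, sum_nbhd,
    sum_adj_erased, sum_ite_erased c n fun x => deg c n x ^ 2, sum_deg_mul_nbhd]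
  simp only [degWeight, degSq]
  linarith

/-! ### One step of the red vertices -/

theorem redVertices_le {c : Choices} {n x : ℕ} (h : x ∈ redVertices c n) : x ≤ n := by
  induction n generalizing x with
  | zero => simp [redVertices] at h
  | succ n ih =>
    have hu := (c n).2.isLt
    have key : ∀ y, y ∈ (if ((c n).1 : ℕ) ∈ redVertices c n
        then insert (n + 1) (redVertices c n) else redVertices c n) → y ≤ n + 1 := by
      intro y hy
      split_ifs at hy
      · rcases Finset.mem_insert.1 hy with rfl | hy
        · rfl
        · exact (ih hy).trans n.le_succ
      · exact (ih hy).trans n.le_succ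
    simp only [redVertices] at h
    split_ifs at h with h1 <;> grind

open Classical in
-- A saved edge forces `v` into the closed neighbourhood of `u`; without one, `v` turns black. Of
-- the red edges only their presence in version 1 is used.
theorem numRed_succ_le (c : Choices) (n : ℕ) :
    (numRed c (n + 1) : ℝ) ≤ numRed c n + (if ((c n).1 : ℕ) ∈ redVertices c n then 1 else 0) -
      (if ((c n).2 : ℕ) ∈ redVertices c n then 1 else 0) + 2 * nbhd c n (c n).2 := by
  have hv := Nat.lt_succ_iff.1 (c n).2.isLt
  have hw : n + 1 ∉ redVertices c n := fun h => by have := redVertices_le h; omega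
  have hvw : ((c n).2 : ℕ) ≠ n + 1 := by omega
  have hJ : (redEdges c (n + 1)).Adj (c n).2 (n + 1) → nbhd c n (c n).2 = 1 := by
    intro h
    have h' : (version1 c (n + 1)).Adj (c n).2 (n + 1) := h.1
    rw [← adj_succ_new hv, adj, if_pos h']
  set R := if ((c n).1 : ℕ) ∈ redVertices c n
      then insert (n + 1) (redVertices c n) else redVertices c n with hR
  have hRc : (R.card : ℝ) = numRed c n + if ((c n).1 : ℕ) ∈ redVertices c n then 1 else 0 := by
    rw [hR]
    split_ifs
    · rw [Finset.card_insert_of_notMem hw]; simp [numRed]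
    · simp [numRed]
  have hvR : ((c n).2 : ℕ) ∈ R ↔ ((c n).2 : ℕ) ∈ redVertices c n := by
    rw [hR]
    split_ifs <;> simp [hvw]
  by_cases h : (redEdges c (n + 1)).Adj (c n).2 (n + 1)
  · have : numRed c (n + 1) = (insert ((c n).2 : ℕ) (insert (n + 1) R)).card := by
      simp only [numRed, redVertices, if_pos h, hR]
    rw [this, hJ h, ← hRc]
    by_cases hm : ((c n).2 : ℕ) ∈ redVertices c n
    · rw [if_pos hm, Finset.insert_eq_of_mem (Finset.mem_insert_of_mem (hvR.2 hm))]
      have : ((insert (n + 1) R).card : ℝ) ≤ R.card + 1 := by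
        exact_mod_cast Finset.card_insert_le _ _
      linarith
    · rw [if_neg hm]
      have h1 : ((insert (n + 1) R).card : ℝ) ≤ R.card + 1 := by
        exact_mod_cast Finset.card_insert_le _ _
      have h2 : ((insert ((c n).2 : ℕ) (insert (n + 1) R)).card : ℝ) ≤
          (insert (n + 1) R).card + 1 := by
        exact_mod_cast Finset.card_insert_le _ _
      linarith
  · have : numRed c (n + 1) = (R.erase (c n).2).card := by
      simp only [numRed, redVertices, if_neg h, hR]
    have hn := nbhd_nonneg c n (c n).2
    rw [this, ← hRc]
    by_cases hm : ((c n).2 : ℕ) ∈ redVertices c n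
    · have := Finset.card_erase_add_one (hvR.2 hm)
      have : ((R.erase (c n).2).card : ℝ) + 1 = R.card := by exact_mod_cast this
      rw [if_pos hm]
      linarith
    · rw [if_neg hm, Finset.erase_eq_of_notMem fun h => hm (hvR.1 h)]
      linarith

/-! ### Conditional drifts -/

theorem update_agree (c : Choices) (n : ℕ) (p : Fin (n + 1) × Fin (n + 1)) :
    ∀ k < n, Function.update c n p k = c k :=
  fun _ hk => Function.update_of_ne hk.ne _ _

theorem stepMean_le {n : ℕ} {f : Choices → ℝ} {c : Choices} {A : ℝ} {F : ℕ → ℕ → ℝ}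
    (h : ∀ p : Fin (n + 1) × Fin (n + 1), f (Function.update c n p) ≤ A + F p.1 p.2) :
    stepMean n f c ≤ A + (∑ x ∈ Finset.range (n + 1), ∑ y ∈ Finset.range (n + 1), F x y) /
      ((n : ℝ) + 1) ^ 2 := by
  have hn : ((n : ℝ) + 1) ≠ 0 := by positivity
  have h2 : ∑ p : Fin (n + 1) × Fin (n + 1), (A + F p.1 p.2) = ((n : ℝ) + 1) ^ 2 * A +
      ∑ x ∈ Finset.range (n + 1), ∑ y ∈ Finset.range (n + 1), F x y := by
    simp only [Finset.sum_add_distrib, Finset.sum_const, Finset.card_univ, Fintype.card_prod,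
      Fintype.card_fin, nsmul_eq_mul, Finset.sum_range, Fintype.sum_prod_type]
    push_cast
    ring
  calc stepMean n f c
      ≤ (∑ p : Fin (n + 1) × Fin (n + 1), (A + F p.1 p.2)) / ((n : ℝ) + 1) ^ 2 := by
        unfold stepMean
        gcongr with p
        exact h p
    _ = _ := by rw [h2]; field_simp

/-- Both vertices are uniform, so `g` and `h` are averaged over the same set and opposite parts
cancel. -/
theorem stepMean_le_of_separated {n : ℕ} {f : Choices → ℝ} {c : Choices} {A : ℝ} {g h : ℕ → ℝ}
    (hf : ∀ p : Fin (n + 1) × Fin (n + 1), f (Function.update c n p) ≤ A + (g p.1 + h p.2)) :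
    stepMean n f c ≤ A + (∑ x ∈ Finset.range (n + 1), (g x + h x)) / ((n : ℝ) + 1) := by
  refine (stepMean_le (F := fun x y => g x + h y) hf).trans (le_of_eq ?_)
  have hn : ((n : ℝ) + 1) ≠ 0 := by positivity
  simp only [Finset.sum_add_distrib, Finset.sum_const, Finset.card_range, nsmul_eq_mul,
    ← Finset.mul_sum]
  push_cast
  field_simp

theorem stepMean_numEdges_le (c : Choices) (n : ℕ) :
    stepMean n (fun c => (numEdges c (n + 1) : ℝ)) c ≤ numEdges c n + 1 := by
  refine (stepMean_le_of_separated (A := numEdges c n + 1) (g := fun x => deg c n x)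
    (h := fun x => - deg c n x) fun p => ?_).trans (by simp)
  rw [numEdges_succ, numEdges_congr (update_agree c n p), deg_congr (update_agree c n p),
    deg_congr (update_agree c n p)]
  simp only [Function.update_self]
  linarith

theorem stepMean_sq_numEdges_le (c : Choices) (n : ℕ) :
    stepMean n (fun c => ((numEdges c (n + 1) : ℝ) - ((n + 1 : ℕ) : ℝ)) ^ 2) c ≤
      ((numEdges c n : ℝ) - n) ^ 2 + 4 * degSq c n / ((n : ℝ) + 1) := by
  refine (stepMean_le_of_separated (A := ((numEdges c n : ℝ) - n) ^ 2)
    (g := fun x => 2 * ((numEdges c n : ℝ) - n) * deg c n x + 2 * deg c n x ^ 2)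
    (h := fun x => - (2 * ((numEdges c n : ℝ) - n) * deg c n x) + 2 * deg c n x ^ 2)
    fun p => ?_).trans (le_of_eq ?_)
  · rw [numEdges_succ, numEdges_congr (update_agree c n p), deg_congr (update_agree c n p),
      deg_congr (update_agree c n p)]
    simp only [Function.update_self]
    push_cast
    -- This is `(a - b) ^ 2 ≤ 2 * a ^ 2 + 2 * b ^ 2`, which avoids a mixed term in the two degrees.
    nlinarith [sq_nonneg (deg c n p.1 + deg c n p.2)]
  · rw [degSq, Finset.mul_sum]
    congr 2
    exact Finset.sum_congr rfl fun x _ => by ring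

theorem stepMean_degSq_le (c : Choices) (n : ℕ) :
    stepMean n (fun c => degSq c (n + 1)) c ≤
      degSq c n + 2 + 12 * numEdges c n / ((n : ℝ) + 1) := by
  refine (stepMean_le_of_separated (A := degSq c n + 2)
    (g := fun x => degWeight c n x + 5 * deg c n x)
    (h := fun x => - degWeight c n x + deg c n x) fun p => ?_).trans (le_of_eq ?_)
  · refine (degSq_succ_le _ n).trans ?_
    simp only [degWeight, degSq_congr (update_agree c n p), deg_congr (update_agree c n p),
      adj_congr (update_agree c n p), Function.update_self]
    linarith
  · have : ∀ x, degWeight c n x + 5 * deg c n x + (- degWeight c n x + deg c n x) =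
        6 * deg c n x := fun x => by ring
    simp only [this]
    rw [← Finset.mul_sum, sum_deg_eq]
    ring

theorem stepMean_numRed_le (c : Choices) (n : ℕ) :
    stepMean n (fun c => (numRed c (n + 1) : ℝ)) c ≤
      numRed c n + 2 * ((n : ℝ) + 1 + 2 * numEdges c n) / ((n : ℝ) + 1) ^ 2 := by
  classical
  refine (stepMean_le (A := numRed c n) (F := fun x y => (if x ∈ redVertices c n then (1 : ℝ) else 0)
    - (if y ∈ redVertices c n then 1 else 0) + 2 * ((if y = x then 1 else 0) + adj c n x y))
    fun p => ?_).trans (le_of_eq ?_)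
  · have h := numRed_succ_le (Function.update c n p) n
    have h1 : redVertices (Function.update c n p) n = redVertices c n :=
      redVertices_congr (update_agree c n p)
    have h2 : numRed (Function.update c n p) n = numRed c n := numRed_congr (update_agree c n p)
    have h3 : nbhd (Function.update c n p) n p.2 =
        (if (p.2 : ℕ) = p.1 then 1 else 0) + adj c n p.1 p.2 := by
      simp only [nbhd, adj_congr (update_agree c n p), Function.update_self]
    simp only [Function.update_self, h2, h3] at h
    refine h.trans (le_of_eq ?_)
    simp only [h1]
    ring_nf
  -- Counting pairs with `v` in the closed neighbourhood of `u`: `n + 1` on the diagonal and two for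
  -- each edge.
  · have h4 : ∑ x ∈ Finset.range (n + 1), ∑ y ∈ Finset.range (n + 1),
        (if y = x then (1 : ℝ) else 0) = n + 1 := by
      rw [Finset.sum_congr rfl fun x hx => by rw [Finset.sum_ite_eq', if_pos hx]]
      simp
    have h5 := sum_deg_eq c n
    simp only [deg] at h5
    simp only [mul_add, Finset.sum_add_distrib, Finset.sum_sub_distrib, ← Finset.mul_sum, h4, h5,
      Finset.sum_const, Finset.card_range, nsmul_eq_mul]
    ring

/-! ### Expectations and almost sure growth bounds -/

section process
variable {Ω : Type*} [MeasurableSpace Ω] {μ : Measure Ω} [IsProbabilityMeasure μ]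
  {c : (n : ℕ) → Ω → Fin (n + 1) × Fin (n + 1)} (hc : IsUniformChoice μ c)

theorem dependsOn_numEdges (n : ℕ) : DependsOn (fun c => (numEdges c n : ℝ)) (Set.Iio n) :=
  fun _ _ h => by simp only [numEdges_congr h]

theorem dependsOn_degSq (n : ℕ) : DependsOn (fun c => degSq c n) (Set.Iio n) :=
  fun _ _ h => by simp only [degSq_congr h]

include hc

theorem integral_numEdges_le (n : ℕ) : ∫ ω, (numEdges (fun k => c k ω) n : ℝ) ∂μ ≤ n := by
  induction n with
  | zero => simp [numEdges_zero]
  | succ n ih =>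
    rw [← integral_stepMean hc (dependsOn_numEdges (n + 1))]
    have i1 := integrable_of_dependsOn (μ := μ) hc.measurable (dependsOn_numEdges n)
    refine (integral_mono (integrable_of_dependsOn hc.measurable
      (dependsOn_stepMean (dependsOn_numEdges (n + 1)))) (i1.add (integrable_const 1))
      fun ω => stepMean_numEdges_le _ n).trans ?_
    simp only [Pi.add_apply]
    rw [integral_add i1 (integrable_const 1)]
    simpa using ih

theorem integral_degSq_le (n : ℕ) : ∫ ω, degSq (fun k => c k ω) n ∂μ ≤ 14 * n := by
  induction n with
  | zero => simp [degSq_zero]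
  | succ n ih =>
    rw [← integral_stepMean hc (dependsOn_degSq (n + 1))]
    have i1 := integrable_of_dependsOn (μ := μ) hc.measurable (dependsOn_numEdges n)
    have i2 := integrable_of_dependsOn (μ := μ) hc.measurable (dependsOn_degSq n)
    refine (integral_mono (integrable_of_dependsOn hc.measurable
      (dependsOn_stepMean (dependsOn_degSq (n + 1))))
      ((i2.add (integrable_const 2)).add ((i1.const_mul 12).div_const ((n : ℝ) + 1)))
      fun ω => stepMean_degSq_le _ n).trans ?_
    simp only [Pi.add_apply]
    rw [integral_add (by exact i2.add (integrable_const 2)) (by exact (i1.const_mul 12).div_const _),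
      integral_add i2 (integrable_const 2), integral_div, integral_const_mul]
    have h := integral_numEdges_le hc n
    have h2 : 12 * ∫ ω, (numEdges (fun k => c k ω) n : ℝ) ∂μ ≤ 12 * ((n : ℝ) + 1) := by linarith
    have h3 := (div_le_iff₀ (by positivity : (0 : ℝ) < n + 1)).2 h2
    simp only [integral_const, probReal_univ, one_smul]
    push_cast
    linarith

/-- A nonnegative process whose conditional means grow by at most `e n` is almost surely
`O(L n)` for increasing weights `L n` such that the expectations of `e n / L n` are summable. -/
theorem ae_le_mul_of_stepMean_le {Y e : ℕ → Choices → ℝ} {K L : ℕ → ℝ}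
    (hY : ∀ n, DependsOn (Y n) (Set.Iio n)) (he : ∀ n, DependsOn (e n) (Set.Iio n))
    (hY0 : ∀ n c, 0 ≤ Y n c) (he0 : ∀ n c, 0 ≤ e n c)
    (hle : ∀ n c, stepMean n (Y (n + 1)) c ≤ Y n c + e n c)
    (hK : ∀ n, ∫ ω, e n (fun k => c k ω) ∂μ ≤ K n)
    (hL0 : ∀ n, 0 < L n) (hL : Monotone L) (hs : Summable fun n => K n / L n) :
    ∀ᵐ ω ∂μ, ∃ C, ∀ n, Y n (fun k => c k ω) ≤ C * L n := by
  have h := ae_bddAbove_of_stepMean_le hc (X := fun n c => Y n c / L n)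
    (a := fun n c => e n c / L n) (b := fun n => K n / L n)
    (fun n x y h => by simp only [hY n h]) (fun n x y h => by simp only [he n h])
    (fun n c => div_nonneg (hY0 n c) (hL0 n).le) (fun n c => div_nonneg (he0 n c) (hL0 n).le)
    (fun n c => ?_) (fun n => ?_) hs
  · filter_upwards [h] with ω ⟨C, hC⟩
    exact ⟨C, fun n => (div_le_iff₀ (hL0 n)).1 (hC n)⟩
  · have h1 : stepMean n (fun c => Y (n + 1) c / L (n + 1)) c =
        stepMean n (Y (n + 1)) c / L (n + 1) := by
      simp only [stepMean, ← Finset.sum_div]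
      rw [div_right_comm]
    rw [h1, ← add_div]
    exact div_le_div₀ (add_nonneg (hY0 n c) (he0 n c)) (hle n c) (hL0 n) (hL n.le_succ)
  · rw [integral_div]
    exact div_le_div_of_nonneg_right (hK n) (hL0 n).le

/-- The constant 56 is `4 * 14`. An exponent above 1 makes the weighted drifts summable, one below 2
is needed for `S n ∼ n`. -/
theorem ae_sq_numEdges_sub_le : ∀ᵐ ω ∂μ, ∃ C : ℝ, ∀ n : ℕ,
    ((numEdges (fun k => c k ω) n : ℝ) - n) ^ 2 ≤ C * ((n : ℝ) + 1) ^ (3 / 2 : ℝ) := by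
  refine ae_le_mul_of_stepMean_le hc (Y := fun n c => ((numEdges c n : ℝ) - n) ^ 2)
    (e := fun n c => 4 * degSq c n / ((n : ℝ) + 1)) (K := fun _ => 56)
    (L := fun n => ((n : ℝ) + 1) ^ (3 / 2 : ℝ))
    (fun n x y h => by simp only [numEdges_congr h]) (fun n x y h => by simp only [degSq_congr h])
    (fun n c => sq_nonneg _)
    (fun n c => div_nonneg (mul_nonneg (by norm_num) (degSq_nonneg c n)) (by positivity))
    (fun n c => stepMean_sq_numEdges_le c n) (fun n => ?_) (fun n => by positivity)
    (fun m n h => by dsimp only; gcongr) ?_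
  · rw [integral_div, integral_const_mul, div_le_iff₀ (by positivity)]
    have := integral_degSq_le hc n
    linarith
  · have h := (summable_nat_add_iff 1).2
      (Real.summable_one_div_nat_rpow.2 (by norm_num : (1 : ℝ) < 3 / 2))
    refine (h.mul_left 56).congr fun n => ?_
    push_cast
    ring

end process

/-! ### Asymptotic comparison and the logarithmic weights -/

theorem isEquivalent_of_sq_sub_le {S : ℕ → ℝ} {C : ℝ}
    (h : ∀ n : ℕ, (S n - n) ^ 2 ≤ C * ((n : ℝ) + 1) ^ (3 / 2 : ℝ)) :
    S ~[atTop] fun n : ℕ => (n : ℝ) := by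
  have h1 : (fun n : ℕ => (S n - n) ^ 2) =O[atTop] fun n : ℕ => ((n : ℝ) + 1) ^ (3 / 2 : ℝ) := by
    refine IsBigO.of_bound C (Eventually.of_forall fun n => ?_)
    rw [Real.norm_of_nonneg (sq_nonneg _), Real.norm_of_nonneg (by positivity)]
    exact h n
  have h2 : (fun n : ℕ => ((n : ℝ) + 1) ^ (3 / 2 : ℝ)) =O[atTop]
      fun n : ℕ => (n : ℝ) ^ (3 / 2 : ℝ) := by
    refine IsBigO.of_bound (2 ^ (3 / 2 : ℝ)) ((eventually_ge_atTop 1).mono fun n hn => ?_)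
    have hn' : (1 : ℝ) ≤ n := by exact_mod_cast hn
    rw [Real.norm_of_nonneg (by positivity), Real.norm_of_nonneg (by positivity),
      ← Real.mul_rpow (by norm_num) (by positivity)]
    gcongr
    linarith
  have h3 : (fun n : ℕ => (n : ℝ) ^ (3 / 2 : ℝ)) =o[atTop] fun n : ℕ => (n : ℝ) ^ (2 : ℝ) := by
    refine (isLittleO_of_tendsto' ((eventually_ge_atTop 1).mono fun n hn h => ?_) ?_)
    · exact absurd h (Real.rpow_pos_of_pos (by exact_mod_cast hn) _).ne'
    · refine ((tendsto_rpow_neg_atTop (by norm_num : (0 : ℝ) < 1 / 2)).comp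
        tendsto_natCast_atTop_atTop).congr' ((eventually_ge_atTop 1).mono fun n hn => ?_)
      have hn' : (0 : ℝ) < n := by exact_mod_cast hn
      simp only [Function.comp_apply]
      rw [← Real.rpow_sub hn']
      norm_num
  have h4 := (h1.trans h2).trans_isLittleO h3
  simp only [Real.rpow_two] at h4
  exact IsLittleO.of_pow (n := 2) h4 (by norm_num)

/-- Cauchy condensation turns the series into one dominated by a multiple of `∑ 1 / k ^ p`. The
shift by 2 keeps the logarithm positive. -/
theorem summable_one_div_mul_log_rpow {p : ℝ} (hp : 1 < p) :
    Summable fun n : ℕ => 1 / ((n : ℝ) * Real.log (n + 2) ^ p) := by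
  have hlog : ∀ n : ℕ, 0 < Real.log ((n : ℝ) + 2) := fun n =>
    Real.log_pos (by have : (0 : ℝ) ≤ n := n.cast_nonneg; linarith)
  refine (summable_condensed_iff_of_nonneg (fun n => ?_) fun m n hm hmn => ?_).1 ?_
  · have := hlog n
    positivity
  · have h1 := hlog m
    have h2 : (m : ℝ) ≤ n := by exact_mod_cast hmn
    have h3 : (0 : ℝ) < m := by exact_mod_cast hm
    gcongr
  · have h := (Real.summable_one_div_nat_rpow.2 hp).mul_left (1 / Real.log 2 ^ p)
    refine Summable.of_norm_bounded_eventually_nat h ((eventually_ge_atTop 1).mono fun k hk => ?_)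
    have hk' : (0 : ℝ) < k := by exact_mod_cast hk
    have h2 : (0 : ℝ) < Real.log 2 := Real.log_pos (by norm_num)
    have h4 : k * Real.log 2 ≤ Real.log (((2 ^ k : ℕ) : ℝ) + 2) := by
      rw [← Real.log_pow]
      refine Real.log_le_log (by positivity) ?_
      push_cast
      linarith
    have h5 : (0 : ℝ) < k * Real.log 2 := by positivity
    have h6 : (2 : ℝ) ^ k * (1 / (((2 ^ k : ℕ) : ℝ) * Real.log (((2 ^ k : ℕ) : ℝ) + 2) ^ p)) =
        1 / Real.log (((2 ^ k : ℕ) : ℝ) + 2) ^ p := by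
      push_cast
      field_simp
    have h7 := hlog (2 ^ k)
    rw [h6, Real.norm_of_nonneg (by positivity)]
    calc _ ≤ 1 / (k * Real.log 2) ^ p := by gcongr
      _ = _ := by rw [Real.mul_rpow hk'.le h2.le]; field_simp

theorem ae_numRed_le {Ω : Type*} [MeasurableSpace Ω] {μ : Measure Ω} [IsProbabilityMeasure μ]
    {c : (n : ℕ) → Ω → Fin (n + 1) × Fin (n + 1)} (hc : IsUniformChoice μ c) {p : ℝ}
    (hp : 1 < p) : ∀ᵐ ω ∂μ, ∃ C : ℝ, ∀ n : ℕ,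
      (numRed (fun k => c k ω) n : ℝ) ≤ C * Real.log ((n : ℝ) + 3) ^ p := by
  have hlog : ∀ n : ℕ, 0 < Real.log ((n : ℝ) + 3) := fun n =>
    Real.log_pos (by have : (0 : ℝ) ≤ n := n.cast_nonneg; linarith)
  refine ae_le_mul_of_stepMean_le hc (Y := fun n c => (numRed c n : ℝ))
    (e := fun n c => 2 * ((n : ℝ) + 1 + 2 * numEdges c n) / ((n : ℝ) + 1) ^ 2)
    (K := fun n => 6 / ((n : ℝ) + 1)) (L := fun n => Real.log ((n : ℝ) + 3) ^ p)
    (fun n x y h => by simp only [numRed_congr h]) (fun n x y h => by simp only [numEdges_congr h])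
    (fun n c => by positivity) (fun n c => by positivity)
    (fun n c => stepMean_numRed_le c n) (fun n => ?_) (fun n => Real.rpow_pos_of_pos (hlog n) _)
    (fun m n h => ?_) ?_
  · have i1 := integrable_of_dependsOn (μ := μ) hc.measurable (dependsOn_numEdges n)
    rw [integral_div, integral_const_mul, integral_add (integrable_const _) (i1.const_mul 2),
      integral_const_mul, integral_const, probReal_univ, one_smul, div_le_div_iff₀ (by positivity)
      (by positivity)]
    have := integral_numEdges_le hc n
    have h1 : 2 * ((n : ℝ) + 1 + 2 * ∫ ω, (numEdges (fun k => c k ω) n : ℝ) ∂μ) ≤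
      6 * ((n : ℝ) + 1) := by linarith
    calc _ ≤ 6 * ((n : ℝ) + 1) * ((n : ℝ) + 1) := by gcongr
      _ = _ := by ring
  · have := hlog m
    dsimp only
    gcongr
  · refine (((summable_nat_add_iff 1).2 (summable_one_div_mul_log_rpow hp)).mul_left 6).congr
      fun n => ?_
    have : (((n + 1 : ℕ) : ℝ) + 2) = n + 3 := by push_cast; ring
    rw [this, div_div]
    push_cast
    ring

theorem isBigO_log_rpow_of_le {Z : ℕ → ℝ} (hZ : ∀ n, 0 ≤ Z n) {p q C : ℝ} (hp : 0 ≤ p)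
    (hpq : p ≤ q) (h : ∀ n : ℕ, Z n ≤ C * Real.log ((n : ℝ) + 3) ^ p) :
    Z =O[atTop] fun n : ℕ => Real.log (n : ℝ) ^ q := by
  -- For `n ≥ 3`, `n + 3 ≤ n ^ 2` gives the factor `2 ^ p`, and `log n ≥ 1` allows raising the
  -- exponent to `q`.
  refine IsBigO.of_bound (|C| * 2 ^ p) ((eventually_ge_atTop 3).mono fun n hn => ?_)
  have hn' : (3 : ℝ) ≤ n := by exact_mod_cast hn
  have h1 : 1 ≤ Real.log n := by
    rw [Real.le_log_iff_exp_le (by linarith)]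
    linarith [Real.exp_one_lt_d9]
  have h2 : Real.log ((n : ℝ) + 3) ≤ 2 * Real.log n := by
    have : 2 * Real.log (n : ℝ) = Real.log ((n : ℝ) ^ 2) := by rw [Real.log_pow]; norm_num
    rw [this]
    exact Real.log_le_log (by linarith) (by nlinarith)
  have h3 : 0 ≤ Real.log ((n : ℝ) + 3) := Real.log_nonneg (by linarith)
  rw [Real.norm_of_nonneg (hZ n), Real.norm_of_nonneg (by positivity)]
  calc Z n ≤ C * Real.log ((n : ℝ) + 3) ^ p := h n
    _ ≤ |C| * (2 * Real.log n) ^ p := by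
      gcongr
      exact le_abs_self C
    _ = |C| * 2 ^ p * Real.log n ^ p := by
      rw [Real.mul_rpow (by norm_num) (by linarith)]; ring
    _ ≤ |C| * 2 ^ p * Real.log n ^ q := by
      gcongr

end DupGraph

theorem mainTheorem5 {Ω : Type*} [MeasurableSpace Ω] (μ : Measure Ω) [IsProbabilityMeasure μ]
    (c : (n : ℕ) → Ω → Fin (n + 1) × Fin (n + 1)) (hc : DupGraph.IsUniformChoice μ c) :
    ∀ᵐ ω ∂μ,
      ((fun n : ℕ => (DupGraph.numEdges (fun k => c k ω) n : ℝ)) ~[atTop] fun n : ℕ => (n : ℝ)) ∧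
      ∀ ε : ℝ, 0 < ε →
        (fun n : ℕ => (DupGraph.numRed (fun k => c k ω) n : ℝ)) =O[atTop]
          fun n : ℕ => Real.log (n : ℝ) ^ (1 + ε) := by
  -- Countably many exponents suffice, so a single null set serves all `ε`.
  have hred : ∀ᵐ ω ∂μ, ∀ j : ℕ, ∃ C : ℝ, ∀ n : ℕ, (DupGraph.numRed (fun k => c k ω) n : ℝ) ≤
      C * Real.log ((n : ℝ) + 3) ^ (1 + 1 / ((j : ℝ) + 1)) :=
    ae_all_iff.2 fun j => DupGraph.ae_numRed_le hc
      (by have : (0 : ℝ) < 1 / ((j : ℝ) + 1) := by positivity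
          linarith)
  filter_upwards [DupGraph.ae_sq_numEdges_sub_le hc, hred] with ω ⟨C, hC⟩ hω
  refine ⟨DupGraph.isEquivalent_of_sq_sub_le hC, fun ε hε => ?_⟩
  obtain ⟨j, hj⟩ := exists_nat_one_div_lt hε
  obtain ⟨C', hC'⟩ := hω j
  exact DupGraph.isBigO_log_rpow_of_le (fun n => Nat.cast_nonneg _) (by positivity)
    (by linarith) hC'
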